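/- Let $G$ be a finite group. For a 2-cocycle $f\in Z^2(G,\mathbb{C}^*)$ (with $G$ acting trivially on $\mathbb{C}^*$) let $\mathbb{C}^fG$ be the twisted group algebra, i.e. the complex algebra with basis $\{u_g\}_{g\in G}$ and multiplication $u_gu_h=f(g,h)u_{gh}$. The cocycle $f$ and its class $[f]\in H^2(G,\mathbb{C}^*)$ are called non-degenerate if $\mathbb{C}^fG$ is isomorphic to a matrix algebra $M_n(\mathbb{C})$ (this depends only on the class), and $G$ is said to be of central type if it admits a non-degenerate 2-cocycle. The group $\mathrm{Aut}(G)$ acts on $H^2(G,\mathbb{C}^*)$ by $\phi([f])=[\phi(f)]$, where $\phi(f)(g,h)=f(\phi^{-1}(g),\phi^{-1}(h))$. An action $\eta:K\to\mathrm{Aut}(G)$ of a group $K$ on $G$ is called symplectic if there is a non-degenerate class in $H^2(G,\mathbb{C}^*)$ that is fixed by $\eta(k)$ for every $k\in K$. (These notions apply to every group, in particular to the Sylow subgroups below.) **Theorem.** Let $G$ be a finite group of A-type, that is, all Sylow subgroups of $G$ are abelian. For every prime $p$ let $G_p$ be a (arbitrarily chosen) Sylow $p$-subgroup of $G$, and let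 the Weyl group $W(G_p)=N_G(G_p)/G_p$ act on $G_p$ by conjugation (this is well defined since $G_p$ is abelian). Then $G$ is of central type if and only if for every prime $p$, $G_p$ is of central type and the action of $W(G_p)$ on $G_p$ is symplectic. -/

import Mathlib

namespace CentralType

noncomputable section

/-- The group `Z²(G, ℂˣ)` of 2-cocycles of `G` with values in the trivial module `ℂˣ`. -/
def twoCocycles (G : Type*) [Group G] : Subgroup (G → G → ℂˣ) where
  carrier := {f | ∀ g h k : G, f g h * f (g * h) k = f h k * f g (h * k)}
  one_mem' := fun _ _ _ => rfl
  mul_mem' := by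
    intro a b ha hb g h k
    simp only [Pi.mul_apply]
    rw [mul_mul_mul_comm, ha g h k, hb g h k, mul_mul_mul_comm]
  inv_mem' := by
    intro a ha g h k
    simp only [Pi.inv_apply]
    rw [← mul_inv, ← mul_inv, ha g h k]

/-- The coboundary map, sending a 1-cochain `x : G → ℂˣ` to the 2-cocycle
`(g, h) ↦ x g * x h / x (g * h)`. -/
def coboundaryMap (G : Type*) [Group G] : (G → ℂˣ) →* twoCocycles G where
  toFun x := ⟨fun g h => x g * x h / x (g * h), by
    intro g h k
    ext
    push_cast
    rw [mul_assoc g h k]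
    field_simp⟩
  map_one' := by
    ext
    simp
  map_mul' := by
    intro x y
    ext g h
    simp only [Pi.mul_apply, Subgroup.coe_mul, mul_div_mul_comm, mul_mul_mul_comm]

/-- The second cohomology group `H²(G, ℂˣ) = Z²(G, ℂˣ) / B²(G, ℂˣ)` (trivial action on `ℂˣ`). -/
abbrev H2 (G : Type*) [Group G] : Type _ := twoCocycles G ⧸ (coboundaryMap G).range

/-- The class `[f]` of a 2-cocycle `f`. -/
abbrev cohomologyClass {G : Type*} [Group G] (f : twoCocycles G) : H2 G :=
  QuotientGroup.mk f

section TwistedGroupAlgebra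

/-- The multiplication `u_g * u_h = f(g, h) u_{gh}` on the vector space with basis
`u_g = single g 1`, as a bilinear map. -/
def twistedMul {G : Type*} [Group G] (f : twoCocycles G) :
    (G →₀ ℂ) →ₗ[ℂ] (G →₀ ℂ) →ₗ[ℂ] (G →₀ ℂ) :=
  Finsupp.lsum ℂ fun g : G => LinearMap.toSpanSingleton ℂ _
    (Finsupp.lsum ℂ fun h : G =>
      ((f.1 g h : ℂˣ) : ℂ) • (Finsupp.lsingle (g * h) : ℂ →ₗ[ℂ] G →₀ ℂ))

lemma twistedMul_single_single {G : Type*} [Group G] (f : twoCocycles G) (g h : G) (a b : ℂ) :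
    twistedMul f (Finsupp.single g a) (Finsupp.single h b)
      = Finsupp.single (g * h) (a * b * (f.1 g h : ℂˣ)) := by
  simp only [twistedMul, Finsupp.lsum_single, LinearMap.toSpanSingleton_apply,
    LinearMap.smul_apply, Finsupp.lsingle_apply, Finsupp.smul_single, smul_eq_mul]
  congr 1
  ring

/-- The twisted group algebra `ℂ^f G`: the complex vector space with basis `u_g = single g 1`,
`g ∈ G`, and multiplication `u_g * u_h = f(g, h) u_{gh}`. -/
def TwistedGroupAlgebra {G : Type*} [Group G] (_f : twoCocycles G) : Type _ := G →₀ ℂ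

namespace TwistedGroupAlgebra

variable {G : Type*} [Group G] {f : twoCocycles G}

instance : AddCommGroup (TwistedGroupAlgebra f) := inferInstanceAs (AddCommGroup (G →₀ ℂ))

instance : Module ℂ (TwistedGroupAlgebra f) := inferInstanceAs (Module ℂ (G →₀ ℂ))

/-- `single f g a` is the element `a • u_g`. -/
def single (f : twoCocycles G) (g : G) (a : ℂ) : TwistedGroupAlgebra f := Finsupp.single g a

instance : Mul (TwistedGroupAlgebra f) := ⟨fun x y => twistedMul f x y⟩

/-- The identity element is `f(1, 1)⁻¹ u_1`. -/
instance : One (TwistedGroupAlgebra f) := ⟨single f 1 (((f.1 1 1 : ℂˣ)⁻¹ : ℂˣ) : ℂ)⟩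

lemma one_def : (1 : TwistedGroupAlgebra f) = single f 1 (((f.1 1 1 : ℂˣ)⁻¹ : ℂˣ) : ℂ) := rfl

lemma single_mul_single (g h : G) (a b : ℂ) :
    single f g a * single f h b = single f (g * h) (a * b * (f.1 g h : ℂˣ)) :=
  twistedMul_single_single f g h a b

lemma induction_linear {p : TwistedGroupAlgebra f → Prop} (x : TwistedGroupAlgebra f)
    (zero : p 0) (add : ∀ x y, p x → p y → p (x + y)) (single : ∀ g a, p (single f g a)) : p x :=
  Finsupp.induction_linear (motive := p) x zero add single

lemma cocycle_one_left (f : twoCocycles G) (g : G) : f.1 1 g = f.1 1 1 := by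
  have := f.2 1 1 g
  simp only [one_mul] at this
  exact (mul_right_cancel this).symm

lemma cocycle_one_right (f : twoCocycles G) (g : G) : f.1 g 1 = f.1 1 1 := by
  have := f.2 g 1 1
  simp only [mul_one] at this
  exact mul_right_cancel this

lemma twisted_mul_add (x y z : TwistedGroupAlgebra f) : x * (y + z) = x * y + x * z :=
  map_add (twistedMul f x) y z

lemma twisted_add_mul (x y z : TwistedGroupAlgebra f) : (x + y) * z = x * z + y * z :=
  LinearMap.map_add₂ (twistedMul f) x y z

lemma twisted_mul_zero (x : TwistedGroupAlgebra f) : x * 0 = 0 :=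
  map_zero (twistedMul f x)

lemma twisted_zero_mul (x : TwistedGroupAlgebra f) : 0 * x = 0 :=
  LinearMap.map_zero₂ (twistedMul f) x

instance : Ring (TwistedGroupAlgebra f) where
  __ := (inferInstance : AddCommGroup (TwistedGroupAlgebra f))
  left_distrib := twisted_mul_add
  right_distrib := twisted_add_mul
  zero_mul := twisted_zero_mul
  mul_zero := twisted_mul_zero
  mul_assoc x y z := by
    induction x using induction_linear with
    | zero => simp only [twisted_zero_mul]
    | add x x' hx hx' => simp only [twisted_add_mul, hx, hx']
    | single g a =>
      induction y using induction_linear with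
      | zero => simp only [twisted_zero_mul, twisted_mul_zero]
      | add y y' hy hy' => simp only [twisted_add_mul, twisted_mul_add, hy, hy']
      | single h b =>
        induction z using induction_linear with
        | zero => simp only [twisted_mul_zero]
        | add z z' hz hz' => simp only [twisted_mul_add, hz, hz']
        | single k c =>
          simp only [single_mul_single, mul_assoc g h k]
          congr 1
          have := congrArg (fun u : ℂˣ => (u : ℂ)) (f.2 g h k)
          push_cast at this
          linear_combination (a * b * c) * this
  one_mul x := by
    induction x using induction_linear with
    | zero => simp only [twisted_mul_zero]
    | add x x' hx hx' => simp only [twisted_mul_add, hx, hx']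
    | single g a =>
      rw [one_def, single_mul_single, one_mul, cocycle_one_left f g]
      congr 1
      push_cast
      field_simp
  mul_one x := by
    induction x using induction_linear with
    | zero => simp only [twisted_zero_mul]
    | add x x' hx hx' => simp only [twisted_add_mul, hx, hx']
    | single g a =>
      rw [one_def, single_mul_single, mul_one, cocycle_one_right f g]
      congr 1
      push_cast
      field_simp

instance : Algebra ℂ (TwistedGroupAlgebra f) :=
  Algebra.ofModule
    (fun r x y => LinearMap.map_smul₂ (twistedMul f) r x y)
    (fun r x y => map_smul (twistedMul f x) r y)

end TwistedGroupAlgebra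

end TwistedGroupAlgebra

/-- A 2-cocycle `f` is non-degenerate if the twisted group algebra `ℂ^f G` is a matrix algebra. -/
def IsNondegenerateCocycle {G : Type*} [Group G] (f : twoCocycles G) : Prop :=
  ∃ n : ℕ, Nonempty (TwistedGroupAlgebra f ≃ₐ[ℂ] Matrix (Fin n) (Fin n) ℂ)

/-- A class in `H²(G, ℂˣ)` is non-degenerate if it is represented by a non-degenerate cocycle
(equivalently, all its representatives are non-degenerate, see `isNondegenerate_mk_iff`). -/
def IsNondegenerate {G : Type*} [Group G] (c : H2 G) : Prop :=
  ∃ f : twoCocycles G, cohomologyClass f = c ∧ IsNondegenerateCocycle f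

lemma isNondegenerateCocycle_of_eq_mul {G : Type*} [Group G] (f f' : twoCocycles G) (x : G → ℂˣ)
    (hx : f' = f * coboundaryMap G x) (hf : IsNondegenerateCocycle f) :
    IsNondegenerateCocycle f' := by
  obtain ⟨n, ⟨e⟩⟩ := hf
  -- the map `u'_g ↦ x g • u_g` is an isomorphism
  let L : TwistedGroupAlgebra f' ≃ₗ[ℂ] TwistedGroupAlgebra f :=
    (LinearEquiv.ofLinearMap
      (Finsupp.lsum ℂ fun g : G => ((x g : ℂˣ) : ℂ) • (Finsupp.lsingle g : ℂ →ₗ[ℂ] G →₀ ℂ))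
      (Finsupp.lsum ℂ fun g : G =>
        (((x g)⁻¹ : ℂˣ) : ℂ) • (Finsupp.lsingle g : ℂ →ₗ[ℂ] G →₀ ℂ))
      (by ext; simp) (by ext; simp) : (G →₀ ℂ) ≃ₗ[ℂ] (G →₀ ℂ))
  have hL : ∀ g a, L (TwistedGroupAlgebra.single f' g a)
      = TwistedGroupAlgebra.single f g (x g * a) := by
    intro g a
    change (Finsupp.lsum ℂ fun g : G =>
      ((x g : ℂˣ) : ℂ) • (Finsupp.lsingle g : ℂ →ₗ[ℂ] G →₀ ℂ)) (Finsupp.single g a)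
        = Finsupp.single g (x g * a)
    simp
  have hmul : ∀ y z, L (y * z) = L y * L z := by
    intro y z
    induction y using TwistedGroupAlgebra.induction_linear with
    | zero => simp
    | add y y' hy hy' => simp only [add_mul, map_add, hy, hy']
    | single g a =>
      induction z using TwistedGroupAlgebra.induction_linear with
      | zero => simp
      | add z z' hz hz' => simp only [mul_add, map_add, hz, hz']
      | single h b =>
        simp only [hL, TwistedGroupAlgebra.single_mul_single]
        congr 1
        subst hx
        simp only [coboundaryMap, MonoidHom.coe_mk, OneHom.coe_mk, Subgroup.coe_mul,
          Pi.mul_apply]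
        push_cast
        field_simp
  have hone : L 1 = 1 := by
    obtain ⟨y, hy⟩ := L.surjective 1
    have := hmul 1 y
    rwa [one_mul, hy, mul_one, eq_comm] at this
  exact ⟨n, ⟨(AlgEquiv.ofLinearEquiv L hone hmul).trans e⟩⟩

lemma isNondegenerate_mk_iff {G : Type*} [Group G] (f : twoCocycles G) :
    IsNondegenerate (cohomologyClass f) ↔ IsNondegenerateCocycle f := by
  refine ⟨?_, fun h => ⟨f, rfl, h⟩⟩
  rintro ⟨f', h, hf'⟩
  obtain ⟨x, hx⟩ := QuotientGroup.eq.mp h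
  exact isNondegenerateCocycle_of_eq_mul f' f x (by rw [hx, mul_inv_cancel_left]) hf'

/-- A group is of central type if it admits a non-degenerate 2-cocycle. -/
def IsCentralType (G : Type*) [Group G] : Prop :=
  ∃ f : twoCocycles G, IsNondegenerateCocycle f

/-- The action of `Aut(G)` on 2-cocycles: `φ(f)(g, h) = f(φ⁻¹ g, φ⁻¹ h)`. -/
instance (G : Type*) [Group G] : MulDistribMulAction (MulAut G) (twoCocycles G) where
  smul φ f := ⟨fun g h => f.1 (φ⁻¹ g) (φ⁻¹ h), fun g h k => by
    simpa only [map_mul] using f.2 (φ⁻¹ g) (φ⁻¹ h) (φ⁻¹ k)⟩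
  one_smul _ := rfl
  mul_smul _ _ _ := rfl
  smul_mul _ _ _ := rfl
  smul_one _ := rfl

lemma smul_coboundaryMap {G : Type*} [Group G] (φ : MulAut G) (x : G → ℂˣ) :
    φ • coboundaryMap G x = coboundaryMap G (fun g => x (φ⁻¹ g)) := by
  apply Subtype.ext
  funext g h
  change x (φ⁻¹ g) * x (φ⁻¹ h) / x (φ⁻¹ g * φ⁻¹ h) = x (φ⁻¹ g) * x (φ⁻¹ h) / x (φ⁻¹ (g * h))
  rw [map_mul]

/-- The action of `Aut(G)` on `H²(G, ℂˣ)`: `φ([f]) = [φ(f)]`. -/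
instance (G : Type*) [Group G] : MulAction (MulAut G) (H2 G) where
  smul φ := QuotientGroup.map _ _ (MulDistribMulAction.toMonoidHom (twoCocycles G) φ) (by
    rintro _ ⟨x, rfl⟩
    exact ⟨_, (smul_coboundaryMap φ x).symm⟩)
  one_smul c := by
    induction c using QuotientGroup.induction_on with
    | H f => exact congrArg cohomologyClass (one_smul (MulAut G) f)
  mul_smul φ ψ c := by
    induction c using QuotientGroup.induction_on with
    | H f => exact congrArg cohomologyClass (mul_smul φ ψ f)

lemma smul_cohomologyClass {G : Type*} [Group G] (φ : MulAut G) (f : twoCocycles G) :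
    φ • cohomologyClass f = cohomologyClass (φ • f) := rfl

/-- The symplectic group `Sp(c)` of a class `c`: its stabilizer in `Aut(G)`. -/
def symplecticGroup {G : Type*} [Group G] (c : H2 G) : Subgroup (MulAut G) :=
  MulAction.stabilizer (MulAut G) c

/-- An action `η : K → Aut(G)` is symplectic if there is a non-degenerate class `c` in
`H²(G, ℂˣ)` such that `η(K) ≤ Sp(c)`. -/
def IsSymplecticAction {K G : Type*} [Group K] [Group G] (η : K →* MulAut G) : Prop :=
  ∃ c : H2 G, IsNondegenerate c ∧ η.range ≤ symplecticGroup c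

/-- The Weyl group `W(H) = N_G(H) / H` of a subgroup `H` of `G`. -/
abbrev WeylGroup {G : Type*} [Group G] (H : Subgroup G) : Type _ :=
  Subgroup.normalizer (H : Set G) ⧸ H.subgroupOf (Subgroup.normalizer (H : Set G))

/-- The action of the Weyl group `W(H)` of an abelian subgroup `H` on `H` induced by the conjugation
action of `N_G(H)`. -/
def weylAction {G : Type*} [Group G] (H : Subgroup G) (hH : IsMulCommutative H) :
    WeylGroup H →* MulAut H :=
  QuotientGroup.lift _ H.normalizerMonoidHom (by
    intro n hn
    have : n ∈ H.normalizerMonoidHom.ker := by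
      rw [Subgroup.normalizerMonoidHom_ker]
      exact Subgroup.mem_subgroupOf.mpr
        (Subgroup.le_centralizer H (Subgroup.mem_subgroupOf.mp hn))
    exact this)

lemma weylAction_mk_apply {G : Type*} [Group G] (H : Subgroup G) (hH : IsMulCommutative H)
    (n : Subgroup.normalizer (H : Set G)) (h : H) :
    ((weylAction H hH (QuotientGroup.mk n) h : H) : G) = n * h * (n : G)⁻¹ := rfl

/-- A group is of A-type if all its Sylow subgroups are abelian. -/
def IsAType (G : Type*) [Group G] : Prop :=
  ∀ p : ℕ, p.Prime → ∀ P : Sylow p G, IsMulCommutative (P : Subgroup G)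

end

end CentralType

/-!
On an abelian group `P` a cocycle `f` is controlled by the alternating bicharacter
`β_f(g, h) = f(g, h) / f(h, g)`, the commutator of `u_g` and `u_h` in `ℂ^f P`: the algebra `ℂ^f P`
is a matrix algebra exactly when `β_f` has trivial radical, and, for finite `P`, `f` is a
coboundary when `β_f = 1`.

If `ℂ^f G ≃ M_n(ℂ)`, then `n² = |G|` and `u_g` has trace zero for `g ≠ 1`. A maximal isotropic
subgroup `L` of a Sylow subgroup `S` then gives an idempotent of trace `n / |L|`, so `|L|` divides
`n`. Hence `|L|² ≤ |S|`, which is possible only if `β_f` is nondegenerate on `S`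
(`IsNondegenerateCocycle.comap_sylow`). The class of `f` restricted to `S` is fixed by the
normalizer, because inner automorphisms act trivially on cohomology
(`range_weylAction_le_symplecticGroup_comap`).

Conversely, let `c_p` be a nondegenerate class on the Sylow subgroup `S_p`, fixed by the Weyl group.
As `S_p` is abelian, fusion in `S_p` is controlled by its normalizer (`exists_normalizer_conj_eq`),
so `c_p` is stable and its corestriction to `G` restricts on `S_p` to a power of `c_p` with exponent
`[G : S_p]` prime to `p` (`exists_corestriction_mul_eq`). A further `[G : S_p]`-th power makes the
pairing trivial on the other Sylow subgroups, and the product of these cocycles over all primes is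
nondegenerate on every Sylow subgroup. Such a cocycle is nondegenerate on `G`: if `ℂ^f G` maps onto
`M_d(ℂ)`, then `|S_p|` divides `d²` for all `p`, so `d² = |G|`
(`isNondegenerateCocycle_of_comap_sylow`).
-/

/-! ### Matrix algebras -/

namespace CentralType

/-- A nonzero finite-dimensional complex algebra maps onto a full matrix algebra: a Wedderburn
block of its quotient by the Jacobson radical. -/
theorem exists_surjective_algHom_matrix (A : Type*) [Ring A] [Algebra ℂ A] [FiniteDimensional ℂ A]
    [Nontrivial A] :
    ∃ d : ℕ, 0 < d ∧ ∃ φ : A →ₐ[ℂ] Matrix (Fin d) (Fin d) ℂ, Function.Surjective φ := by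
  have := IsArtinianRing.of_finite ℂ A
  have : IsSemisimpleRing (A ⧸ Ring.jacobson A) := inferInstance
  have : Nontrivial (A ⧸ Ring.jacobson A) :=
    Submodule.Quotient.nontrivial_iff.mpr (Ring.jacobson_lt_top A).ne
  obtain ⟨n, d, hd, ⟨e⟩⟩ :=
    IsSemisimpleRing.exists_algEquiv_pi_matrix_of_isAlgClosed ℂ (A ⧸ Ring.jacobson A)
  have hn : 0 < n := by
    by_contra h
    obtain rfl : n = 0 := by omega
    exact not_subsingleton _ e.toEquiv.subsingleton
  let i : Fin n := ⟨0, hn⟩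
  refine ⟨d i, Nat.pos_of_ne_zero (hd i).out,
    (Pi.evalAlgHom ℂ (fun i => Matrix (Fin (d i)) (Fin (d i)) ℂ) i).comp
      ((e : _ →ₐ[ℂ] _).comp (Ideal.Quotient.mkₐ ℂ (Ring.jacobson A))), ?_⟩
  exact (Function.surjective_eval i).comp (e.surjective.comp Ideal.Quotient.mk_surjective)

theorem exists_trace_eq_natCast_of_isIdempotentElem {n : ℕ} {e : Matrix (Fin n) (Fin n) ℂ}
    (he : IsIdempotentElem e) : ∃ r : ℕ, e.trace = r := by
  have h : IsIdempotentElem (Matrix.toLin' e) := by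
    rw [IsIdempotentElem, Module.End.mul_eq_comp, ← Matrix.toLin'_mul, he.eq]
  exact ⟨Module.finrank ℂ (Matrix.toLin' e).range, by
    rw [← Matrix.trace_toLin'_eq]
    exact (LinearMap.IsIdempotentElem.isProj_range _ h).trace⟩

/-- The images of the diagonal matrix units are conjugate idempotents summing to `1`, hence have
equal integer traces with sum `d`. -/
theorem dvd_of_algHom_matrix {m d : ℕ}
    (φ : Matrix (Fin m) (Fin m) ℂ →ₐ[ℂ] Matrix (Fin d) (Fin d) ℂ) : m ∣ d := by
  have hE : ∀ i : Fin m, IsIdempotentElem (φ (Matrix.single i i 1)) := fun i => by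
    rw [IsIdempotentElem, ← map_mul, Matrix.single_mul_single_same, one_mul]
  have htr : ∀ i j : Fin m, (φ (Matrix.single i i 1)).trace = (φ (Matrix.single j j 1)).trace := by
    intro i j
    have h1 : Matrix.single i i (1 : ℂ) = Matrix.single i j 1 * Matrix.single j i 1 := by simp
    have h2 : Matrix.single j j (1 : ℂ) = Matrix.single j i 1 * Matrix.single i j 1 := by simp
    rw [h1, h2, map_mul, map_mul, Matrix.trace_mul_comm]
  have hsum : (d : ℂ) = ∑ i : Fin m, (φ (Matrix.single i i 1)).trace := by
    rw [← Matrix.trace_sum, ← map_sum, Matrix.sum_single_one, map_one]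
    simp
  rcases Nat.eq_zero_or_pos m with rfl | hm
  · simpa using hsum
  · obtain ⟨r, hr⟩ := exists_trace_eq_natCast_of_isIdempotentElem (hE ⟨0, hm⟩)
    refine ⟨r, ?_⟩
    rw [Finset.sum_congr rfl fun i _ => (htr i ⟨0, hm⟩).trans hr] at hsum
    simp only [Finset.sum_const, Finset.card_univ, Fintype.card_fin, nsmul_eq_mul] at hsum
    exact_mod_cast hsum

end CentralType

/-! ### Twisted group algebras and the commutator pairing -/

namespace CentralType

namespace TwistedGroupAlgebra

variable {G : Type*} [Group G]

/-- The basis `u_g`, `g ∈ G`, of the twisted group algebra. -/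
noncomputable def basis (f : twoCocycles G) : Module.Basis G ℂ (TwistedGroupAlgebra f) :=
  (Finsupp.basisSingleOne : Module.Basis G ℂ (G →₀ ℂ))

theorem basis_apply (f : twoCocycles G) (g : G) : basis f g = single f g 1 :=
  congrFun (Finsupp.coe_basisSingleOne (R := ℂ)) g

instance (f : twoCocycles G) [Finite G] : FiniteDimensional ℂ (TwistedGroupAlgebra f) :=
  (basis f).finiteDimensional_of_finite

instance (f : twoCocycles G) : Nontrivial (TwistedGroupAlgebra f) :=
  ⟨basis f 1, 0, (basis f).ne_zero 1⟩

theorem finrank_eq_card (f : twoCocycles G) :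
    Module.finrank ℂ (TwistedGroupAlgebra f) = Nat.card G :=
  Module.finrank_eq_nat_card_basis (basis f)

theorem smul_single (f : twoCocycles G) (a b : ℂ) (g : G) :
    a • single f g b = single f g (a * b) :=
  Finsupp.smul_single' a g b

theorem cocycle_inv_comm (f : twoCocycles G) (g : G) : f.1 g⁻¹ g = f.1 g g⁻¹ := by
  have := f.2 g g⁻¹ g
  rw [mul_inv_cancel, inv_mul_cancel, cocycle_one_left f g, cocycle_one_right f g] at this
  exact (mul_right_cancel this).symm

/-- The basis vector `u_g`, as a unit of the twisted group algebra. -/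
noncomputable def unitOf (f : twoCocycles G) (g : G) : (TwistedGroupAlgebra f)ˣ where
  val := single f g 1
  inv := single f g⁻¹ (((f.1 g g⁻¹ * f.1 1 1)⁻¹ : ℂˣ) : ℂ)
  val_inv := by
    rw [single_mul_single, mul_inv_cancel, one_def, one_mul, ← Units.val_mul]
    congr 2
    rw [mul_inv_rev, inv_mul_cancel_right]
  inv_val := by
    rw [single_mul_single, inv_mul_cancel, one_def, mul_one, cocycle_inv_comm, ← Units.val_mul]
    congr 2
    rw [mul_inv_rev, inv_mul_cancel_right]

theorem coe_unitOf (f : twoCocycles G) (g : G) :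
    (unitOf f g : TwistedGroupAlgebra f) = basis f g := (basis_apply f g).symm

/-- The central embedding of the nonzero scalars into the units of the twisted group algebra. -/
noncomputable def scalar (f : twoCocycles G) : ℂˣ →* (TwistedGroupAlgebra f)ˣ :=
  Units.map (algebraMap ℂ (TwistedGroupAlgebra f) : ℂ →* TwistedGroupAlgebra f)

theorem coe_scalar_mul (f : twoCocycles G) (a : ℂˣ) (x : (TwistedGroupAlgebra f)ˣ) :
    ((scalar f a * x : (TwistedGroupAlgebra f)ˣ) : TwistedGroupAlgebra f)
      = (a : ℂ) • (x : TwistedGroupAlgebra f) :=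
  (Algebra.smul_def _ _).symm

theorem scalar_comm (f : twoCocycles G) (a : ℂˣ) (x : (TwistedGroupAlgebra f)ˣ) :
    x * scalar f a = scalar f a * x :=
  Units.ext (Algebra.commutes (a : ℂ) (x : TwistedGroupAlgebra f)).symm

theorem unitOf_mul (f : twoCocycles G) (g h : G) :
    unitOf f g * unitOf f h = scalar f (f.1 g h) * unitOf f (g * h) := by
  apply Units.ext
  rw [coe_scalar_mul]
  change single f g 1 * single f h 1 = _ • single f (g * h) 1
  rw [single_mul_single, smul_single, one_mul, one_mul, mul_one]

theorem unitOf_one (f : twoCocycles G) : unitOf f 1 = scalar f (f.1 1 1) := by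
  have := unitOf_mul f 1 1
  rw [mul_one] at this
  exact mul_right_cancel this

theorem scalar_mul_unitOf_injective (f : twoCocycles G) {a b : ℂˣ} {g : G}
    (h : scalar f a * unitOf f g = scalar f b * unitOf f g) : a = b := by
  have := congrArg Units.val h
  rw [coe_scalar_mul, coe_scalar_mul] at this
  exact Units.ext (smul_left_injective ℂ (by rw [coe_unitOf]; exact (basis f).ne_zero g) this)

theorem scalar_mul_unitOf_mul (f : twoCocycles G) (a b : ℂˣ) (g h : G) :
    scalar f a * unitOf f g * (scalar f b * unitOf f h)
      = scalar f (a * b * f.1 g h) * unitOf f (g * h) := by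
  rw [map_mul, map_mul, mul_assoc (scalar f a * scalar f b), ← unitOf_mul, mul_assoc, mul_assoc,
    ← mul_assoc (unitOf f g), scalar_comm, mul_assoc]

/-- `w` is homogeneous of degree `g`: a nonzero scalar multiple of `u_g`. -/
def IsHomogeneous (f : twoCocycles G) (g : G) (w : (TwistedGroupAlgebra f)ˣ) : Prop :=
  ∃ a : ℂˣ, w = scalar f a * unitOf f g

theorem isHomogeneous_unitOf (f : twoCocycles G) (g : G) : IsHomogeneous f g (unitOf f g) :=
  ⟨1, by rw [map_one, one_mul]⟩

theorem IsHomogeneous.mul {f : twoCocycles G} {g h : G} {v w : (TwistedGroupAlgebra f)ˣ}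
    (hv : IsHomogeneous f g v) (hw : IsHomogeneous f h w) : IsHomogeneous f (g * h) (v * w) := by
  obtain ⟨a, rfl⟩ := hv
  obtain ⟨b, rfl⟩ := hw
  exact ⟨a * b * f.1 g h, scalar_mul_unitOf_mul f a b g h⟩

theorem IsHomogeneous.inv {f : twoCocycles G} {g : G} {v : (TwistedGroupAlgebra f)ˣ}
    (hv : IsHomogeneous f g v) : IsHomogeneous f g⁻¹ v⁻¹ := by
  obtain ⟨a, rfl⟩ := hv
  have h : (unitOf f g)⁻¹ = scalar f (f.1 g g⁻¹ * f.1 1 1)⁻¹ * unitOf f g⁻¹ := by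
    apply Units.ext
    rw [coe_scalar_mul]
    change _ = _ • single f g⁻¹ 1
    rw [smul_single, mul_one]
    rfl
  exact ⟨(f.1 g g⁻¹ * f.1 1 1)⁻¹ * a⁻¹, by
    rw [mul_inv_rev, h, ← map_inv, mul_assoc, scalar_comm, ← mul_assoc, ← map_mul]⟩

end TwistedGroupAlgebra

open TwistedGroupAlgebra

variable {G : Type*} [Group G]

/-- The function `β_f(g, h) = f(g, h) / f(h, g)`. It is meaningful for commuting `g`, `h`, where
it is the commutator of `u_g` and `u_h`; on an abelian group it is an alternating bicharacter. -/
def commPairing (f : twoCocycles G) (g h : G) : ℂˣ := f.1 g h / f.1 h g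

theorem commPairing_self (f : twoCocycles G) (g : G) : commPairing f g g = 1 := div_self' _

theorem commPairing_swap (f : twoCocycles G) (g h : G) :
    commPairing f h g = (commPairing f g h)⁻¹ := (inv_div _ _).symm

theorem unitOf_mul_comm (f : twoCocycles G) {g h : G} (hgh : g * h = h * g) :
    unitOf f g * unitOf f h = scalar f (commPairing f g h) * (unitOf f h * unitOf f g) := by
  rw [unitOf_mul, unitOf_mul, hgh, ← mul_assoc, ← map_mul, commPairing, div_mul_cancel]

theorem commPairing_mul_left (f : twoCocycles G) {g g' h : G} (hg : g * h = h * g)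
    (hg' : g' * h = h * g') :
    commPairing f (g * g') h = commPairing f g h * commPairing f g' h := by
  have h1 := f.2 g g' h
  have h2 := f.2 h g g'
  have h3 := f.2 g h g'
  rw [hg'] at h1
  rw [hg] at h3
  simp only [commPairing]
  rw [div_mul_div_comm, div_eq_div_iff_mul_eq_mul]
  rw [← Units.val_inj] at *
  push_cast at *
  have n1 := (f.1 g g').ne_zero
  have n2 := (f.1 (h*g) g').ne_zero
  have n3 := (f.1 g (h*g')).ne_zero
  apply mul_left_cancel₀ n1
  apply mul_left_cancel₀ n2
  apply mul_left_cancel₀ n3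
  linear_combination (f.1 h g * f.1 (h * g) g' * (f.1 h g' * f.1 g (h * g')) : ℂ) * h1
    + (f.1 g' h * f.1 g (h * g') * (f.1 h g' * f.1 g (h * g')) : ℂ) * h2
    - (f.1 g' h * f.1 g (h * g') * (f.1 g g' * f.1 h (g * g')) : ℂ) * h3

end CentralType

/-! ### Nondegenerate cocycles on abelian groups -/

namespace CentralType

open TwistedGroupAlgebra

theorem exists_eq_algebraMap_of_commute {d : ℕ} {M : Matrix (Fin d) (Fin d) ℂ}
    (h : ∀ N, N * M = M * N) : ∃ a : ℂ, algebraMap ℂ _ a = M := by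
  have : M ∈ Subalgebra.center ℂ (Matrix (Fin d) (Fin d) ℂ) := Subalgebra.mem_center_iff.mpr h
  exact Algebra.mem_bot.mp (Algebra.IsCentral.out this)

variable {P : Type*} [Group P]

theorem commPairing_mul_right (f : twoCocycles P) {g h h' : P} (hh : g * h = h * g)
    (hh' : g * h' = h' * g) :
    commPairing f g (h * h') = commPairing f g h * commPairing f g h' := by
  rw [commPairing_swap f (h * h') g, commPairing_mul_left f hh.symm hh'.symm, mul_inv,
    ← commPairing_swap, ← commPairing_swap]

/-- For a commutative group, the character `h ↦ β_f(g, h)`. -/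
def pairingHom (f : twoCocycles P) (hP : ∀ g h : P, g * h = h * g) (g : P) : P →* ℂˣ :=
  MonoidHom.mk' (commPairing f g) fun _ _ => commPairing_mul_right f (hP _ _) (hP _ _)

theorem pairingHom_apply (f : twoCocycles P) (hP : ∀ g h : P, g * h = h * g) (g h : P) :
    pairingHom f hP g h = commPairing f g h := rfl

/-- The radical `{g | ∀ h, β_f(g, h) = 1}` of the pairing `β_f` is trivial. The notion is used for
abelian groups. -/
def HasNondegeneratePairing (f : twoCocycles P) : Prop :=
  ∀ g : P, (∀ h, commPairing f g h = 1) → g = 1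

theorem basis_mul_comm (f : twoCocycles P) {g h : P} (hgh : g * h = h * g)
    (h1 : commPairing f g h = 1) : basis f g * basis f h = basis f h * basis f g := by
  have := congrArg Units.val (unitOf_mul_comm f hgh)
  rw [h1, map_one, one_mul] at this
  simpa only [Units.val_mul, coe_unitOf] using this

theorem commute_basis_of_forall (f : twoCocycles P) (hP : ∀ g h : P, g * h = h * g) {g : P}
    (hg : ∀ h, commPairing f g h = 1) (x : TwistedGroupAlgebra f) :
    x * basis f g = basis f g * x := by
  have : LinearMap.mulRight ℂ (basis f g) = LinearMap.mulLeft ℂ (basis f g) :=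
    (basis f).ext fun h => (basis_mul_comm f (hP g h) (hg h)).symm
  exact DFunLike.congr_fun this x

/-- If `g` is in the radical of `β_f` then `u_g` is central, hence a scalar. -/
theorem IsNondegenerateCocycle.hasNondegeneratePairing {f : twoCocycles P}
    (hP : ∀ g h : P, g * h = h * g) (hf : IsNondegenerateCocycle f) :
    HasNondegeneratePairing f := by
  intro g hg
  obtain ⟨n, ⟨e⟩⟩ := hf
  obtain ⟨a, ha⟩ := exists_eq_algebraMap_of_commute (M := e (basis f g)) fun N => by
    obtain ⟨x, rfl⟩ := e.surjective N
    rw [← map_mul, ← map_mul, commute_basis_of_forall f hP hg]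
  rw [← e.commutes, e.injective.eq_iff, Algebra.algebraMap_eq_smul_one, one_def] at ha
  rw [smul_single, ← mul_one (a * _), ← smul_single, ← basis_apply] at ha
  by_contra hne
  have := congrArg (fun x => (basis f).repr x g) ha
  simp [Ne.symm hne] at this

/-- A symmetric cocycle `f` on a finite abelian group is the coboundary of a cochain `x`. Here
`ℂ^f P` is commutative, so its image in a matrix quotient is scalar, and `x g` is the image of
`u_g`. -/
theorem exists_mul_eq_of_commPairing_eq_one [Finite P] (f : twoCocycles P)
    (hP : ∀ g h : P, g * h = h * g) (hf : ∀ g h, commPairing f g h = 1) :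
    ∃ x : P → ℂˣ, ∀ g h, x g * x h = f.1 g h * x (g * h) := by
  obtain ⟨d, hd, φ, hφ⟩ := exists_surjective_algHom_matrix (TwistedGroupAlgebra f)
  have : NeZero d := ⟨hd.ne'⟩
  have hx : ∀ g, ∃ a : ℂˣ, algebraMap ℂ _ (a : ℂ) = φ (unitOf f g) := by
    intro g
    obtain ⟨a, ha⟩ := exists_eq_algebraMap_of_commute (M := φ (unitOf f g)) fun N => by
      obtain ⟨x, rfl⟩ := hφ N
      rw [← map_mul, ← map_mul, coe_unitOf, commute_basis_of_forall f hP (hf g)]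
    have ha0 : a ≠ 0 := by
      rintro rfl
      rw [map_zero] at ha
      exact ((unitOf f g).isUnit.map φ).ne_zero ha.symm
    exact ⟨Units.mk0 a ha0, ha⟩
  choose x hx using hx
  refine ⟨x, fun g h => Units.ext ?_⟩
  apply (algebraMap ℂ (Matrix (Fin d) (Fin d) ℂ)).injective
  rw [Units.val_mul, Units.val_mul, map_mul, map_mul, hx, hx, hx, ← map_mul, ← Units.val_mul,
    unitOf_mul, coe_scalar_mul, map_smul, Algebra.smul_def]

/-- For an abelian group, nondegeneracy of `β_f` makes `ℂ^f P` simple: it embeds into any matrix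
algebra onto which it maps. -/
theorem HasNondegeneratePairing.isNondegenerateCocycle [Finite P] {f : twoCocycles P}
    (hP : ∀ g h : P, g * h = h * g) (hf : HasNondegeneratePairing f) :
    IsNondegenerateCocycle f := by
  obtain ⟨d, hd, φ, hφ⟩ := exists_surjective_algHom_matrix (TwistedGroupAlgebra f)
  have : NeZero d := ⟨hd.ne'⟩
  have := Fintype.ofFinite P
  classical
  refine ⟨d, ⟨AlgEquiv.ofBijective φ ⟨(injective_iff_map_eq_zero φ).mpr fun a ha => ?_, hφ⟩⟩⟩
  -- `T k a = ∑ h, β_f(k, h) • u_h a u_h⁻¹` isolates the `k`-th coefficient of `a`, by orthogonality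
  -- of the characters `β_f(g, ·)`; so the kernel of `φ` is zero.
  let T : P → TwistedGroupAlgebra f →ₗ[ℂ] TwistedGroupAlgebra f := fun k =>
    ∑ h : P, (((commPairing f k h : ℂˣ) : ℂ)) •
      (LinearMap.mulLeft ℂ (unitOf f h : TwistedGroupAlgebra f) ∘ₗ
        LinearMap.mulRight ℂ (((unitOf f h)⁻¹ : _ˣ) : TwistedGroupAlgebra f))
  have hT : ∀ k g, T k (basis f g) = if g = k then (Nat.card P : ℂ) • basis f g else 0 := by
    intro k g
    have h1 : ∀ h : P, (unitOf f h : TwistedGroupAlgebra f) * (basis f g *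
        (((unitOf f h)⁻¹ : _ˣ) : TwistedGroupAlgebra f))
          = ((commPairing f g h)⁻¹ : ℂˣ) • basis f g := by
      intro h
      rw [← coe_unitOf, ← Units.val_mul, ← Units.val_mul, ← mul_assoc, unitOf_mul_comm f (hP h g),
        mul_assoc, mul_assoc, mul_inv_cancel, mul_one, coe_scalar_mul, commPairing_swap]
      rfl
    have h2 : T k (basis f g)
        = (∑ h : P, ((Units.coeHom ℂ).comp (pairingHom f hP k / pairingHom f hP g)) h)
            • basis f g := by
      simp only [T, LinearMap.sum_apply, LinearMap.smul_apply, LinearMap.comp_apply,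
        LinearMap.mulLeft_apply, LinearMap.mulRight_apply, h1, Finset.sum_smul]
      refine Finset.sum_congr rfl fun h _ => ?_
      rw [Units.smul_def, smul_smul]
      simp [pairingHom_apply, div_eq_mul_inv]
    rw [h2]
    split_ifs with hgk
    · subst hgk
      simp
    · rw [sum_hom_units_eq_zero, zero_smul]
      intro h3
      apply hgk
      refine (mul_inv_eq_one.mp (hf (k * g⁻¹) fun h => ?_)).symm
      have h4 : commPairing f k h = commPairing f g h :=
        div_eq_one.mp (Units.ext (DFunLike.congr_fun h3 h))
      have h5 := commPairing_mul_left f (hP (k * g⁻¹) h) (hP g h)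
      rwa [inv_mul_cancel_right, h4, right_eq_mul] at h5
  have hTa : ∀ k, T k a = ((Nat.card P : ℂ) * (basis f).repr a k) • basis f k := by
    intro k
    conv_lhs => rw [← (basis f).sum_repr a]
    rw [map_sum, Finset.sum_eq_single k]
    · rw [map_smul, hT, if_pos rfl, smul_smul, mul_comm]
    · intro g _ hg
      rw [map_smul, hT, if_neg hg, smul_zero]
    · simp
  apply (basis f).repr.map_eq_zero_iff.mp
  ext k
  have hk : φ (T k a) = 0 := by
    simp [T, ha]
  rw [hTa, map_smul, ← coe_unitOf] at hk
  have := (smul_eq_zero.mp hk).resolve_right ((unitOf f k).isUnit.map φ).ne_zero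
  simpa [Nat.card_pos.ne'] using this

end CentralType

/-! ### Restriction to abelian Sylow subgroups -/

namespace CentralType

open TwistedGroupAlgebra

variable {G H P : Type*} [Group G] [Group H] [Group P]

/-- The pullback of a cocycle along a group homomorphism. -/
def comap (φ : H →* G) (f : twoCocycles G) : twoCocycles H :=
  ⟨fun g h => f.1 (φ g) (φ h), fun g h k => by
    simpa only [map_mul] using f.2 (φ g) (φ h) (φ k)⟩

theorem comap_apply (φ : H →* G) (f : twoCocycles G) (g h : H) :
    (comap φ f).1 g h = f.1 (φ g) (φ h) := rfl

theorem trace_mulLeft_matrix {n : ℕ} (M : Matrix (Fin n) (Fin n) ℂ) :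
    LinearMap.trace ℂ _ (LinearMap.mulLeft ℂ M) = n * M.trace := by
  rw [LinearMap.trace_eq_matrix_trace ℂ (Matrix.stdBasis ℂ (Fin n) (Fin n)), Matrix.trace,
    Fintype.sum_prod_type]
  have : ∀ i j, (LinearMap.toMatrix (Matrix.stdBasis ℂ (Fin n) (Fin n))
      (Matrix.stdBasis ℂ (Fin n) (Fin n)) (LinearMap.mulLeft ℂ M)).diag (i, j) = M i i := by
    intro i j
    rw [Matrix.diag_apply, LinearMap.toMatrix_apply, Matrix.stdBasis_eq_single]
    simp [Matrix.stdBasis, Matrix.mul_single_apply_same]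
  simp only [this]
  simp [Matrix.trace, Finset.mul_sum]

theorem trace_mulLeft_basis [Finite G] (f : twoCocycles G) {g : G} (hg : g ≠ 1) :
    LinearMap.trace ℂ _ (LinearMap.mulLeft ℂ (basis f g)) = 0 := by
  classical
  have := Fintype.ofFinite G
  rw [LinearMap.trace_eq_matrix_trace ℂ (basis f), Matrix.trace]
  refine Finset.sum_eq_zero fun h _ => ?_
  rw [Matrix.diag_apply, LinearMap.toMatrix_apply, LinearMap.mulLeft_apply, basis_apply,
    basis_apply, single_mul_single, ← mul_one (_ * _ * _), ← smul_single, ← basis_apply, map_smul]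
  simp [hg]

/-- Up to the factor `n` the trace on `M_n(ℂ)` is the trace of the regular representation, for
which `u_g` with `g ≠ 1` permutes the lines `ℂ u_h` without fixed line. -/
theorem trace_algEquiv_basis [Finite G] {f : twoCocycles G} {n : ℕ}
    (e : TwistedGroupAlgebra f ≃ₐ[ℂ] Matrix (Fin n) (Fin n) ℂ) {g : G} (hg : g ≠ 1) :
    (e (basis f g)).trace = 0 := by
  have h := trace_mulLeft_basis f hg
  have h' : e.toLinearEquiv.conj (LinearMap.mulLeft ℂ (basis f g))
      = LinearMap.mulLeft ℂ (e (basis f g)) := by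
    ext1 M
    simp [LinearEquiv.conj_apply]
  rw [← LinearMap.trace_conj' _ e.toLinearEquiv, h', trace_mulLeft_matrix, mul_eq_zero] at h
  refine h.resolve_left fun h0 => ?_
  obtain rfl : n = 0 := by exact_mod_cast h0
  exact not_subsingleton _ e.toEquiv.subsingleton

theorem mul_self_eq_card [Finite G] {f : twoCocycles G} {n : ℕ}
    (e : TwistedGroupAlgebra f ≃ₐ[ℂ] Matrix (Fin n) (Fin n) ℂ) : n * n = Nat.card G := by
  rw [← finrank_eq_card f, e.toLinearEquiv.finrank_eq, Module.finrank_matrix]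
  simp

/-- An isotropic subgroup `H` has order dividing `n` when `ℂ^f G ≃ M_n(ℂ)`: after rescaling, the
`u_h` form a genuine representation of `H`, and the averaging idempotent has trace `n / |H|`. -/
theorem card_dvd_of_commPairing_eq_one [Finite G] [Finite H] {f : twoCocycles G} {n : ℕ}
    (e : TwistedGroupAlgebra f ≃ₐ[ℂ] Matrix (Fin n) (Fin n) ℂ) (hH : ∀ g h : H, g * h = h * g)
    (φ : H →* G) (hφ : Function.Injective φ)
    (h1 : ∀ g h, commPairing (comap φ f) g h = 1) : Nat.card H ∣ n := by
  have := Fintype.ofFinite H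
  obtain ⟨x, hx⟩ := exists_mul_eq_of_commPairing_eq_one (comap φ f) hH h1
  have hx1 : x 1 = f.1 1 1 := by
    have := hx 1 1
    rw [mul_one] at this
    simpa [comap_apply] using mul_right_cancel this
  let ρ : H → Matrix (Fin n) (Fin n) ℂ := fun h =>
    e (((scalar f (x h)⁻¹ * unitOf f (φ h) : _ˣ)) : TwistedGroupAlgebra f)
  have hρ : ∀ g h, ρ g * ρ h = ρ (g * h) := by
    intro g h
    rw [← map_mul, ← Units.val_mul, mul_assoc, ← mul_assoc (unitOf f _), scalar_comm, mul_assoc,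
      unitOf_mul, ← mul_assoc, ← mul_assoc, ← map_mul, ← map_mul, ← comap_apply, ← map_mul φ]
    have : (x g)⁻¹ * (x h)⁻¹ * (comap φ f).1 g h = (x (g * h))⁻¹ := by
      rw [← mul_inv, hx, mul_inv, mul_comm (_)⁻¹, inv_mul_cancel_right]
    rw [this]
  have htr : ∀ h, h ≠ 1 → (ρ h).trace = 0 := by
    intro h hh
    simp only [ρ]
    rw [coe_scalar_mul, coe_unitOf, map_smul, Matrix.trace_smul, trace_algEquiv_basis e,
      smul_zero]
    rwa [Ne, map_eq_one_iff φ hφ]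
  have htr1 : (ρ 1).trace = n := by
    simp only [ρ]
    rw [map_one φ, unitOf_one, ← map_mul, hx1, inv_mul_cancel, map_one, Units.val_one, map_one,
      Matrix.trace_one, Fintype.card_fin]
  have hc : (Nat.card H : ℂ) ≠ 0 := by exact_mod_cast Nat.card_pos.ne'
  have hS : ∀ g, ρ g * ∑ h, ρ h = ∑ h, ρ h := fun g => by
    rw [Finset.mul_sum]
    simp only [hρ]
    exact _root_.Equiv.sum_comp (Equiv.mulLeft g) ρ
  have hidem : IsIdempotentElem ((Nat.card H : ℂ)⁻¹ • ∑ h, ρ h) := by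
    rw [IsIdempotentElem, smul_mul_smul_comm]
    nth_rw 1 [Finset.sum_mul]
    simp only [hS]
    rw [Finset.sum_const, Finset.card_univ, ← Nat.card_eq_fintype_card, ← Nat.cast_smul_eq_nsmul ℂ,
      smul_smul]
    congr 1
    field_simp
  obtain ⟨r, hr⟩ := exists_trace_eq_natCast_of_isIdempotentElem hidem
  rw [Matrix.trace_smul, Matrix.trace_sum, Finset.sum_eq_single 1 (fun h _ => htr h) (by simp),
    htr1, smul_eq_mul, inv_mul_eq_iff_eq_mul₀ hc] at hr
  exact ⟨r, by exact_mod_cast hr⟩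

theorem card_monoidHom_units_complex [Finite P] (hP : ∀ g h : P, g * h = h * g) :
    Nat.card (P →* ℂˣ) = Nat.card P :=
  letI : CommGroup P := { ‹Group P› with mul_comm := hP }
  CommGroup.card_monoidHom_of_hasEnoughRootsOfUnity P ℂ

theorem exists_monoidHom_units_complex_apply_ne_one [Finite P] (hP : ∀ g h : P, g * h = h * g)
    {a : P} (ha : a ≠ 1) : ∃ χ : P →* ℂˣ, χ a ≠ 1 :=
  letI : CommGroup P := { ‹Group P› with mul_comm := hP }
  CommGroup.exists_apply_ne_one_of_hasEnoughRootsOfUnity P ℂ ha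

/-- A maximal isotropic subgroup equals its own orthogonal complement. -/
theorem exists_isotropic_self_orthogonal [Finite P] (f : twoCocycles P)
    (hP : ∀ g h : P, g * h = h * g) :
    ∃ L : Subgroup P, ∀ g, g ∈ L ↔ ∀ h ∈ L, commPairing f g h = 1 := by
  obtain ⟨L, hL⟩ := (Set.toFinite {L : Subgroup P | ∀ g ∈ L, ∀ h ∈ L,
    commPairing f g h = 1}).exists_maximal ⟨⊥, by
      rintro g hg h hh
      rw [Subgroup.mem_bot.mp hg, Subgroup.mem_bot.mp hh, commPairing_self]⟩
  refine ⟨L, fun g => ⟨hL.prop g, fun hg => ?_⟩⟩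
  have h1 : ∀ a ∈ insert g (L : Set P), ∀ b ∈ insert g (L : Set P), commPairing f a b = 1 := by
    rintro a (rfl | ha) b (rfl | hb)
    · exact commPairing_self f _
    · exact hg b hb
    · rw [commPairing_swap, hg a ha, inv_one]
    · exact hL.prop a ha b hb
  have h2 : Subgroup.closure (insert g (L : Set P)) ≤ L := by
    refine hL.le_of_ge ?_ fun a ha => Subgroup.subset_closure (Set.mem_insert_of_mem _ ha)
    have h3 : ∀ a ∈ insert g (L : Set P), ∀ b ∈ Subgroup.closure (insert g (L : Set P)),
        commPairing f a b = 1 := by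
      intro a ha b hb
      exact (Subgroup.closure_le (K := (pairingHom f hP a).ker)).mpr (h1 a ha) hb
    intro a ha b hb
    rw [commPairing_swap, inv_eq_one]
    refine (Subgroup.closure_le (K := (pairingHom f hP b).ker)).mpr (fun c hc => ?_) ha
    rw [SetLike.mem_coe, MonoidHom.mem_ker, pairingHom_apply, commPairing_swap, h3 c hc b hb,
      inv_one]
  exact h2 (Subgroup.subset_closure (Set.mem_insert _ _))

/-- The pairing embeds `P / L` into the characters of `L` that are trivial on the radical of
`β_f`. If the radical is nontrivial these are fewer than `|L|`, which forces `|P| < |L|²`. -/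
theorem hasNondegeneratePairing_of_card_le [Finite P] (f : twoCocycles P)
    (hP : ∀ g h : P, g * h = h * g) (L : Subgroup P)
    (hL : ∀ g, g ∈ L ↔ ∀ h ∈ L, commPairing f g h = 1)
    (hc : Nat.card L * Nat.card L ≤ Nat.card P) : HasNondegeneratePairing f := by
  intro r hr
  by_contra hr1
  have hrL : r ∈ L := (hL r).mpr fun h _ => hr h
  have hLc : ∀ g h : L, g * h = h * g := fun g h => Subtype.ext (hP g h)
  let Φ : P →* (L →* ℂˣ) := MonoidHom.mk' (fun g => (pairingHom f hP g).comp L.subtype)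
    fun g g' => by
      ext1 h
      exact commPairing_mul_left f (hP _ _) (hP _ _)
  have hker : Φ.ker = L := by
    ext g
    rw [MonoidHom.mem_ker, hL]
    exact ⟨fun h a ha => DFunLike.congr_fun h ⟨a, ha⟩, fun h => by ext1 a; exact h a a.2⟩
  have hcard := card_monoidHom_units_complex hLc
  have : Finite (L →* ℂˣ) := Nat.finite_of_card_ne_zero (by rw [hcard]; exact Nat.card_pos.ne')
  have hne : Φ.range ≠ ⊤ := by
    intro htop
    obtain ⟨χ, hχ⟩ := exists_monoidHom_units_complex_apply_ne_one hLc
      (a := ⟨r, hrL⟩) (fun h => hr1 (congrArg Subtype.val h))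
    obtain ⟨g, rfl⟩ : χ ∈ Φ.range := htop ▸ Subgroup.mem_top χ
    exact hχ (by
      change commPairing f g r = 1
      rw [commPairing_swap, hr, inv_one])
  have h1 : Nat.card Φ.range < Nat.card L := by
    rw [← hcard]
    refine lt_of_le_of_ne (Subgroup.card_le_card_group _) fun h => hne ?_
    exact Subgroup.eq_top_of_card_eq _ h
  have h2 : Nat.card L * Nat.card Φ.range = Nat.card P := by
    rw [← Subgroup.index_ker, hker, Subgroup.card_mul_index]
  have h3 : 0 < Nat.card L := Nat.card_pos
  nlinarith

/-- Restriction to an abelian Sylow subgroup preserves nondegeneracy: with `|G| = n²`, a maximal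
isotropic subgroup `L` of `S` has order dividing `n`, so `|L|²` divides the `p`-part `|S|` of
`|G|`. -/
theorem IsNondegenerateCocycle.comap_sylow [Finite G] {p : ℕ} [Fact p.Prime] (S : Sylow p G)
    (hS : IsMulCommutative (S : Subgroup G)) {f : twoCocycles G} (hf : IsNondegenerateCocycle f) :
    HasNondegeneratePairing (comap (S : Subgroup G).subtype f) := by
  obtain ⟨n, ⟨e⟩⟩ := hf
  have hP : ∀ g h : (S : Subgroup G), g * h = h * g := fun g h => mul_comm' g h
  obtain ⟨L, hL⟩ := exists_isotropic_self_orthogonal (comap (S : Subgroup G).subtype f) hP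
  refine hasNondegeneratePairing_of_card_le _ hP L hL ?_
  have hdvd : Nat.card L ∣ n := by
    refine card_dvd_of_commPairing_eq_one e (fun g h => Subtype.ext (hP g h))
      ((S : Subgroup G).subtype.comp L.subtype)
      (Subtype.val_injective.comp Subtype.val_injective) fun g h => ?_
    exact (hL g).mp g.2 h h.2
  have h1 : Nat.card L * Nat.card L ∣ Nat.card G := by
    rw [← mul_self_eq_card e]
    exact mul_dvd_mul hdvd hdvd
  obtain ⟨k, hk⟩ := (IsPGroup.iff_card.mp (S.2.to_subgroup L))
  rw [hk, ← pow_add] at h1 ⊢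
  rw [Sylow.card_eq_multiplicity]
  exact Nat.pow_le_pow_right (Fact.out : p.Prime).pos
    ((Nat.Prime.pow_dvd_iff_le_factorization Fact.out Nat.card_pos.ne').mp h1)

end CentralType

/-! ### Corestriction of stable classes -/

namespace CentralType

open TwistedGroupAlgebra

variable {G : Type*} [Group G]

/-- For a section `s` of `G → G ⧸ P`, the element of `P` comparing `s (g • x)` with `g * s x`. -/
def transition {P : Subgroup G} {s : G ⧸ P → G} (hs : ∀ x, (s x : G ⧸ P) = x) (g : G)
    (x : G ⧸ P) : P :=
  ⟨(s (g • x))⁻¹ * (g * s x), by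
    rw [← QuotientGroup.eq, hs, ← smul_eq_mul, ← MulAction.Quotient.smul_coe, hs]⟩

theorem transition_mul {P : Subgroup G} {s : G ⧸ P → G} (hs : ∀ x, (s x : G ⧸ P) = x) (g h : G)
    (x : G ⧸ P) : transition hs (g * h) x = transition hs g (h • x) * transition hs h x := by
  apply Subtype.ext
  simp only [transition, Subgroup.coe_mul, mul_smul]
  group

/-- The corestriction (transfer) of a cocycle from `P` to `G`, as the explicit cocycle attached to
a section `s` of `G → G ⧸ P`. -/
def corestriction {P : Subgroup G} [Fintype (G ⧸ P)] {s : G ⧸ P → G}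
    (hs : ∀ x, (s x : G ⧸ P) = x) (f : twoCocycles P) : twoCocycles G :=
  ⟨fun g h => ∏ x : G ⧸ P, f.1 (transition hs g (h • x)) (transition hs h x), fun g h k => by
    beta_reduce
    rw [← Equiv.prod_comp (MulAction.toPerm k : Equiv.Perm (G ⧸ P)) fun x =>
      f.1 (transition hs g (h • x)) (transition hs h x), ← Finset.prod_mul_distrib,
      ← Finset.prod_mul_distrib]
    refine Finset.prod_congr rfl fun x _ => ?_
    rw [MulAction.toPerm_apply, transition_mul, transition_mul, mul_smul]
    exact f.2 _ _ _⟩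

theorem corestriction_apply {P : Subgroup G} [Fintype (G ⧸ P)] {s : G ⧸ P → G}
    (hs : ∀ x, (s x : G ⧸ P) = x) (f : twoCocycles P) (g h : G) :
    (corestriction hs f).1 g h
      = ∏ x : G ⧸ P, f.1 (transition hs g (h • x)) (transition hs h x) := rfl

/-- Burnside's fusion argument: conjugation by `t` agrees with conjugation by an element of the
normalizer of the abelian Sylow subgroup `S` on all of `S ∩ t S t⁻¹` simultaneously. Both `S` and
`t S t⁻¹` are Sylow subgroups of the centralizer of this intersection. -/
theorem exists_normalizer_conj_eq {p : ℕ} [Fact p.Prime] [Finite G] (S : Sylow p G)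
    [IsMulCommutative (S : Subgroup G)] (t : G) :
    ∃ n ∈ Subgroup.normalizer ((S : Subgroup G) : Set G),
      ∀ q ∈ S, t⁻¹ * q * t ∈ S → t⁻¹ * q * t = n⁻¹ * q * n := by
  let Q : Set G := {q | q ∈ S ∧ t⁻¹ * q * t ∈ S}
  have hcomm : ∀ a ∈ S, ∀ b ∈ S, a * b = b * a := fun a ha b hb =>
    congrArg Subtype.val (mul_comm' (⟨a, ha⟩ : (S : Subgroup G)) ⟨b, hb⟩)
  have h1 : (S : Subgroup G) ≤ Subgroup.centralizer Q := fun a ha q hq => hcomm _ hq.1 _ ha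
  have h2 : ((t • S : Sylow p G) : Subgroup G) ≤ Subgroup.centralizer Q := by
    rintro - ⟨z, hz, rfl⟩ q hq
    have := hcomm _ hq.2 _ hz
    change q * (t * z * t⁻¹) = t * z * t⁻¹ * q
    calc q * (t * z * t⁻¹) = t * ((t⁻¹ * q * t) * z) * t⁻¹ := by group
      _ = t * (z * (t⁻¹ * q * t)) * t⁻¹ := by rw [this]
      _ = _ := by group
  obtain ⟨h, hh⟩ := MulAction.exists_smul_eq (Subgroup.centralizer Q) ((t • S).subtype h2)
    (S.subtype h1)
  simp_rw [Sylow.smul_subtype, Subgroup.smul_def, smul_smul] at hh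
  refine ⟨h * t, Sylow.smul_eq_iff_mem_normalizer.mp (Sylow.subtype_injective hh), ?_⟩
  intro q hq hq'
  have := h.2 q ⟨hq, hq'⟩
  calc t⁻¹ * q * t = t⁻¹ * (h : G)⁻¹ * (h * q) * t := by group
    _ = t⁻¹ * (h : G)⁻¹ * (q * h) * t := by rw [this]
    _ = _ := by group

/-- A section of `G → G ⧸ P` of the form `y x * t x` with `y x ∈ P` and `t` constant on the
`P`-orbits, that is, on the double cosets of `P`. -/
theorem exists_orbit_section (P : Subgroup G) :
    ∃ (y : G ⧸ P → P) (t : G ⧸ P → G), (∀ x, ((y x * t x : G) : G ⧸ P) = x) ∧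
      ∀ (g : P) x, t ((g : G) • x) = t x := by
  let x₀ : G ⧸ P → G ⧸ P := fun x =>
    Quotient.out (Quotient.mk (MulAction.orbitRel P (G ⧸ P)) x)
  have hy : ∀ x, ∃ y : P, y • x₀ x = x := fun x =>
    (MulAction.orbitRel P (G ⧸ P)).symm (Quotient.mk_out (s := MulAction.orbitRel P (G ⧸ P)) x)
  choose y hy using hy
  refine ⟨y, fun x => (x₀ x).out, fun x => ?_, fun g x => ?_⟩
  · conv_rhs => rw [← hy x]
    rw [← smul_eq_mul, ← MulAction.Quotient.smul_coe, QuotientGroup.out_eq']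
    rfl
  · have : Quotient.mk (MulAction.orbitRel P (G ⧸ P)) ((g : G) • x) = Quotient.mk _ x :=
      Quotient.sound (s := MulAction.orbitRel P (G ⧸ P)) ⟨g, rfl⟩
    simp only [x₀, this]

/-- Suppose that `f` is stable: for each `t`, conjugation by `t` on `P ∩ t P t⁻¹` agrees with a
map `σ` of `P` along which `f` pulls back to a cocycle cohomologous to `f`. Then for a suitable
section the corestriction of `f` restricts on `P` to a cocycle cohomologous to `f ^ [G : P]`. -/
theorem exists_corestriction_mul_eq {P : Subgroup G} [Fintype (G ⧸ P)] (f : twoCocycles P)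
    (hf : ∀ t : G, ∃ (σ : P → P) (a : P → ℂˣ),
      (∀ q : P, t⁻¹ * q * t ∈ P → (σ q : G) = t⁻¹ * q * t) ∧
      ∀ q q', f.1 (σ q) (σ q') * a (q * q') = f.1 q q' * (a q * a q')) :
    ∃ (s : G ⧸ P → G) (hs : ∀ x, (s x : G ⧸ P) = x) (C : P → ℂˣ), ∀ g h : P,
      (corestriction hs f).1 g h * C (g * h) = f.1 g h ^ P.index * (C g * C h) := by
  obtain ⟨y, t, hs, ht⟩ := exists_orbit_section P
  choose σ a hσ ha using hf
  let q : P → G ⧸ P → P := fun g x => (y ((g : G) • x))⁻¹ * g * y x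
  have hqmul : ∀ (g h : P) x, q g ((h : G) • x) * q h x = q (g * h) x := by
    intro g h x
    simp only [q, Subgroup.coe_mul, mul_smul]
    group
  -- For `g ∈ P` the transition element is `t⁻¹ (q g x) t` with `q g x ∈ P`, so stability applies.
  have hκ : ∀ (g : P) x, transition hs g x = σ (t x) (q g x) := by
    intro g x
    have : (transition hs g x : G) = (t x)⁻¹ * q g x * t x := by
      simp only [transition, q, ht, Subgroup.coe_mul, Subgroup.coe_inv]
      group
    apply Subtype.ext
    rw [hσ, this]
    rw [← this]
    exact (transition hs g x).2
  -- Lifting `q g x` to the twisted group algebra compares `f (q g (h • x)) (q h x)` with `f g h`.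
  have hb : ∀ (g : P) x, ∃ b : ℂˣ, (unitOf f (y ((g : G) • x)))⁻¹ * unitOf f g * unitOf f (y x)
      = scalar f b * unitOf f (q g x) := fun g x =>
    ((isHomogeneous_unitOf f _).inv.mul (isHomogeneous_unitOf f g)).mul (isHomogeneous_unitOf f _)
  choose b hb using hb
  have hbmul : ∀ (g h : P) x, b g ((h : G) • x) * b h x * f.1 (q g ((h : G) • x)) (q h x)
      = f.1 g h * b (g * h) x := by
    intro g h x
    apply scalar_mul_unitOf_injective f (g := q (g * h) x)
    calc _ = scalar f (b g ((h : G) • x)) * unitOf f (q g ((h : G) • x))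
          * (scalar f (b h x) * unitOf f (q h x)) := by
          rw [scalar_mul_unitOf_mul, hqmul]
      _ = (unitOf f (y ((g : G) • (h : G) • x)))⁻¹ * (unitOf f g * unitOf f h)
          * unitOf f (y x) := by
          rw [← hb, ← hb]
          group
      _ = scalar f (f.1 g h) * ((unitOf f (y (((g * h : P) : G) • x)))⁻¹ * unitOf f (g * h)
          * unitOf f (y x)) := by
          rw [unitOf_mul, ← mul_assoc, scalar_comm, Subgroup.coe_mul, mul_smul, mul_assoc,
            mul_assoc, mul_assoc]
      _ = _ := by
          rw [hb, map_mul, mul_assoc]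
  refine ⟨_, hs, fun g => ∏ x, a (t x) (q g x) / b g x, fun g h => ?_⟩
  beta_reduce
  rw [corestriction_apply, Subgroup.index_eq_card, Nat.card_eq_fintype_card,
    ← Finset.card_univ, ← Finset.prod_const,
    ← Equiv.prod_comp (MulAction.toPerm (h : G) : Equiv.Perm (G ⧸ P)) fun x =>
      a (t x) (q g x) / b g x, ← Finset.prod_mul_distrib, ← Finset.prod_mul_distrib,
    ← Finset.prod_mul_distrib]
  refine Finset.prod_congr rfl fun x _ => ?_
  rw [MulAction.toPerm_apply, hκ, hκ, ht, ← hqmul, ← mul_div_assoc, ha, div_mul_div_comm,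
    ← mul_div_assoc, div_eq_div_iff_mul_eq_mul]
  calc _ = (b g ((h : G) • x) * b h x * f.1 (q g ((h : G) • x)) (q h x)) *
        (a (t x) (q g ((h : G) • x)) * a (t x) (q h x)) := by
        simp only [mul_comm, mul_left_comm]
    _ = _ := by
        rw [hbmul]
        simp only [mul_comm, mul_left_comm]

end CentralType

/-! ### From Sylow subgroups to the whole group -/

namespace CentralType

open TwistedGroupAlgebra

variable {G H : Type*} [Group G] [Group H]

/-- The homomorphism of twisted group algebras `u_h ↦ u_{φ h}`. -/
noncomputable def comapAlgHom (φ : H →* G) (f : twoCocycles G) :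
    TwistedGroupAlgebra (comap φ f) →ₐ[ℂ] TwistedGroupAlgebra f :=
  AlgHom.ofLinearMap ((basis (comap φ f)).constr ℂ fun h => basis f (φ h))
    (by
      rw [one_def, one_def, ← mul_one (Units.val _), ← smul_single, ← basis_apply, map_smul,
        Module.Basis.constr_basis, basis_apply, smul_single, comap_apply, map_one, mul_one])
    (by
      set L := (basis (comap φ f)).constr ℂ fun h => basis f (φ h) with hL
      have hLb : ∀ h, L (basis (comap φ f) h) = basis f (φ h) := fun h =>
        (basis (comap φ f)).constr_basis ℂ _ h
      have : (LinearMap.mul ℂ (TwistedGroupAlgebra (comap φ f))).compr₂ L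
          = (LinearMap.mul ℂ (TwistedGroupAlgebra f)).compl₁₂ L L := by
        refine (basis _).ext fun g => (basis _).ext fun h => ?_
        simp only [LinearMap.compr₂_apply, LinearMap.mul_apply', LinearMap.compl₁₂_apply, hLb]
        have h1 := congrArg Units.val (unitOf_mul (comap φ f) g h)
        have h2 := congrArg Units.val (unitOf_mul f (φ g) (φ h))
        rw [coe_scalar_mul, Units.val_mul, coe_unitOf, coe_unitOf, coe_unitOf] at h1 h2
        rw [h1, h2, map_smul, hLb, map_mul, comap_apply]
      exact fun x y => DFunLike.congr_fun (DFunLike.congr_fun this x) y)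

/-- If `ℂ^f G` maps onto `M_d(ℂ)`, then `M_k(ℂ) ≃ ℂ^f S_p` maps to `M_d(ℂ)` for each `p`, so
`|S_p| = k²` divides `d²`. Hence `|G|` divides `d²`, and the surjection is bijective for reasons
of dimension. -/
theorem isNondegenerateCocycle_of_comap_sylow [Finite G] (S : (p : Nat.Primes) → Sylow (p : ℕ) G)
    (f : twoCocycles G)
    (hf : ∀ p : Nat.Primes, IsNondegenerateCocycle (comap (S p : Subgroup G).subtype f)) :
    IsNondegenerateCocycle f := by
  obtain ⟨d, hd, φ, hφ⟩ := exists_surjective_algHom_matrix (TwistedGroupAlgebra f)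
  have hdvd : Nat.card G ∣ d * d := by
    refine (Nat.factorization_prime_le_iff_dvd Nat.card_pos.ne' (mul_pos hd hd).ne').mp
      fun p hp => ?_
    have := Fact.mk hp
    obtain ⟨k, ⟨e⟩⟩ := hf ⟨p, hp⟩
    have hk : k ∣ d := dvd_of_algHom_matrix ((φ.comp (comapAlgHom _ f)).comp e.symm.toAlgHom)
    rw [← hp.pow_dvd_iff_le_factorization (mul_pos hd hd).ne',
      ← Sylow.card_eq_multiplicity (S ⟨p, hp⟩)]
    have := mul_self_eq_card e
    exact this ▸ mul_dvd_mul hk hk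
  have hrank : Module.finrank ℂ (TwistedGroupAlgebra f)
      = Module.finrank ℂ (Matrix (Fin d) (Fin d) ℂ) := by
    refine le_antisymm ?_ (LinearMap.finrank_le_finrank_of_surjective (f := φ.toLinearMap) hφ)
    rw [finrank_eq_card, Module.finrank_matrix]
    simpa using Nat.le_of_dvd (mul_pos hd hd) hdvd
  exact ⟨d, ⟨AlgEquiv.ofBijective φ ⟨(LinearMap.injective_iff_surjective_of_finrank_eq_finrank
    (f := φ.toLinearMap) hrank).mpr hφ, hφ⟩⟩⟩

theorem coe_weylAction_mk_inv_apply (P : Subgroup G) (hP : IsMulCommutative P)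
    (n : Subgroup.normalizer (P : Set G)) (q : P) :
    (((weylAction P hP (QuotientGroup.mk n))⁻¹ q : P) : G) = (n : G)⁻¹ * q * n := by
  rw [← map_inv, ← QuotientGroup.mk_inv, weylAction_mk_apply]
  simp

theorem smul_cohomologyClass_eq_iff (φ : MulAut H) (f : twoCocycles H) :
    φ • cohomologyClass f = cohomologyClass f ↔ ∃ x : H → ℂˣ, ∀ g h,
      f.1 (φ⁻¹ g) (φ⁻¹ h) * x (g * h) = f.1 g h * (x g * x h) := by
  rw [smul_cohomologyClass, eq_comm, QuotientGroup.eq]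
  refine exists_congr fun x => ?_
  rw [eq_inv_mul_iff_mul_eq, Subtype.ext_iff, funext_iff]
  simp_rw [funext_iff]
  refine forall₂_congr fun g h => ?_
  change f.1 g h * (x g * x h / x (g * h)) = f.1 (φ⁻¹ g) (φ⁻¹ h) ↔ _
  rw [← mul_div_assoc, div_eq_iff_eq_mul, eq_comm]

/-- Inner automorphisms act trivially on cohomology: conjugating `u_g` by `u_n` gives a multiple
of `u_{n⁻¹ g n}`, and the multipliers are the required cochain. -/
theorem range_weylAction_le_symplecticGroup_comap (P : Subgroup G)
    (hP : IsMulCommutative P) (f : twoCocycles G) :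
    (weylAction P hP).range ≤ symplecticGroup (cohomologyClass (comap P.subtype f)) := by
  rintro _ ⟨k, rfl⟩
  obtain ⟨n, rfl⟩ := QuotientGroup.mk_surjective k
  rw [symplecticGroup, MulAction.mem_stabilizer_iff, smul_cohomologyClass_eq_iff]
  have hx : ∀ g : P, ∃ x : ℂˣ, (unitOf f n)⁻¹ * unitOf f g * unitOf f n
      = scalar f x * unitOf f ((n : G)⁻¹ * g * n) := fun g =>
    ((isHomogeneous_unitOf f _).inv.mul (isHomogeneous_unitOf f _)).mul (isHomogeneous_unitOf f _)
  choose x hx using hx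
  refine ⟨fun g => (x g)⁻¹, fun g h => ?_⟩
  have : x g * x h * f.1 ((n : G)⁻¹ * g * n) ((n : G)⁻¹ * h * n) = f.1 g h * x (g * h) := by
    apply scalar_mul_unitOf_injective f (g := (n : G)⁻¹ * (g * h) * n)
    calc _ = scalar f (x g) * unitOf f ((n : G)⁻¹ * g * n)
          * (scalar f (x h) * unitOf f ((n : G)⁻¹ * h * n)) := by
          rw [scalar_mul_unitOf_mul]
          congr 2
          group
      _ = (unitOf f n)⁻¹ * (unitOf f g * unitOf f h) * unitOf f n := by
          rw [← hx, ← hx]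
          group
      _ = scalar f (f.1 g h) * ((unitOf f n)⁻¹ * unitOf f ((g * h : P) : G) * unitOf f n) := by
          rw [unitOf_mul, ← mul_assoc, scalar_comm, Subgroup.coe_mul, mul_assoc, mul_assoc,
            mul_assoc]
      _ = _ := by
          rw [hx, map_mul, mul_assoc (scalar f _), Subgroup.coe_mul]
  rw [comap_apply, comap_apply, Subgroup.coe_subtype, coe_weylAction_mk_inv_apply,
    coe_weylAction_mk_inv_apply, ← mul_inv, ← div_eq_mul_inv, ← div_eq_mul_inv,
    div_eq_div_iff_mul_eq_mul, ← this]
  simp only [mul_comm]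

/-- The homomorphism `f ↦ β_f(g, h)` for fixed `g`, `h`. -/
def commPairingHom (g h : G) : twoCocycles G →* ℂˣ :=
  MonoidHom.mk' (fun f => commPairing f g h) fun _ _ => mul_div_mul_comm _ _ _ _

theorem exists_corestriction_commPairing_eq [Finite G] {p : ℕ} [Fact p.Prime] (S : Sylow p G)
    (hS : IsMulCommutative (S : Subgroup G)) (f : twoCocycles (S : Subgroup G))
    (hf : (weylAction (S : Subgroup G) hS).range ≤ symplecticGroup (cohomologyClass f)) :
    ∃ F : twoCocycles G, ∀ g h : (S : Subgroup G),
      commPairing F (g : G) h = commPairing f g h ^ (S : Subgroup G).index := by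
  have := Fintype.ofFinite (G ⧸ (S : Subgroup G))
  obtain ⟨s, hs, C, hC⟩ := exists_corestriction_mul_eq f fun t => by
    obtain ⟨n, hn, ht⟩ := exists_normalizer_conj_eq S t
    obtain ⟨a, ha⟩ := (smul_cohomologyClass_eq_iff _ f).mp
      (hf ⟨QuotientGroup.mk ⟨n, hn⟩, rfl⟩)
    refine ⟨_, a, fun q hq => ?_, ha⟩
    rw [coe_weylAction_mk_inv_apply, ht q q.2 hq]
  refine ⟨corestriction hs f, fun g h => ?_⟩
  have h1 := hC g h
  have h2 := hC h g
  rw [mul_comm' h g] at h2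
  rw [commPairing, commPairing, div_pow, ← mul_div_mul_right_eq_div _ _ (C (g * h)), h1, h2,
    mul_comm (C g), mul_div_mul_right_eq_div]

/-- A symplectic Weyl action at `p` yields a cocycle of `G` that is nondegenerate on the Sylow
`p`-subgroup and has trivial pairing on abelian subgroups of order prime to `p`. It is the
`[G : S]`-th power of a corestriction `F`; the exponent kills the pairing of `F` on the latter
subgroups and is invertible on the former. -/
theorem exists_cocycle_of_isSymplecticAction [Finite G] {p : ℕ} [Fact p.Prime] (S : Sylow p G)
    (hS : IsMulCommutative (S : Subgroup G))
    (h : IsSymplecticAction (weylAction (S : Subgroup G) hS)) :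
    ∃ F : twoCocycles G, HasNondegeneratePairing (comap (S : Subgroup G).subtype F) ∧
      ∀ Q : Subgroup G, IsMulCommutative Q → (Nat.card Q).Coprime p →
        ∀ g h : Q, commPairing F (g : G) h = 1 := by
  obtain ⟨c, ⟨f, rfl, hf⟩, hc⟩ := h
  obtain ⟨F, hF⟩ := exists_corestriction_commPairing_eq S hS f hc
  have hSc : ∀ g h : (S : Subgroup G), g * h = h * g := fun g h => mul_comm' g h
  set m := (S : Subgroup G).index with hm
  have hpow : ∀ g h : G, commPairing (F ^ m) g h = commPairing F g h ^ m := fun g h =>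
    map_pow (commPairingHom g h) F m
  refine ⟨F ^ m, fun g hg => ?_, fun Q hQ hp g h => ?_⟩
  · refine hf.hasNondegeneratePairing hSc g fun h => ?_
    have h1 : commPairing f g h ^ (m * m) = 1 := by
      rw [pow_mul, ← hF, ← hpow]
      exact hg h
    have h2 : commPairing f g h ^ Nat.card (S : Subgroup G) = 1 := by
      rw [← pairingHom_apply f hSc, ← map_pow, pow_card_eq_one', map_one]
    have h3 : (Nat.card (S : Subgroup G)).Coprime (m * m) :=
      Nat.Coprime.mul_right S.card_coprime_index S.card_coprime_index
    have h4 := pow_gcd_eq_one.mpr ⟨h2, h1⟩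
    rwa [h3.gcd_eq_one, pow_one] at h4
  · have hQc : ∀ g h : Q, g * h = h * g := fun g h => mul_comm' g h
    have h2 : commPairing F (g : G) h ^ Nat.card Q = 1 := by
      change pairingHom (comap Q.subtype F) hQc g h ^ Nat.card Q = 1
      rw [← map_pow, pow_card_eq_one', map_one]
    have h3 : Nat.card Q ∣ m := by
      refine Nat.Coprime.dvd_of_dvd_mul_left (m := Nat.card (S : Subgroup G)) ?_ ?_
      · rw [Sylow.card_eq_multiplicity]
        exact hp.pow_right _
      · rw [hm, Subgroup.card_mul_index]
        exact Subgroup.card_subgroup_dvd_card Q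
    obtain ⟨k, hk⟩ := h3
    rw [hpow, hk, pow_mul, h2, one_pow]

theorem isCentralType_of_isSymplecticAction [Finite G] (hG : IsAType G)
    (S : (p : Nat.Primes) → Sylow (p : ℕ) G)
    (h : ∀ p, IsSymplecticAction (weylAction (S p : Subgroup G) (hG p p.2 (S p)))) :
    IsCentralType G := by
  have hprime : ∀ p : Nat.Primes, Fact (p : ℕ).Prime := fun p => ⟨p.2⟩
  choose F hF hF1 using fun p => exists_cocycle_of_isSymplecticAction (S p) _ (h p)
  let T : Finset Nat.Primes := (Nat.card G).primeFactors.subtype Nat.Prime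
  refine ⟨∏ p ∈ T, F p, isNondegenerateCocycle_of_comap_sylow S _ fun q => ?_⟩
  have hq := hG q q.2 (S q)
  refine HasNondegeneratePairing.isNondegenerateCocycle (fun g h => mul_comm' g h) ?_
  by_cases hqT : q ∈ T
  · intro g hg
    refine hF q g fun h => ?_
    rw [← hg h]
    change _ = commPairingHom (g : G) h (∏ p ∈ T, F p)
    rw [map_prod, Finset.prod_eq_single_of_mem q hqT]
    · rfl
    · intro p _ hpq
      refine hF1 p (S q) hq ?_ g h
      rw [Sylow.card_eq_multiplicity]
      refine Nat.Coprime.pow_left _ ((Nat.coprime_primes q.2 p.2).mpr fun h => hpq ?_)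
      exact Subtype.ext h.symm
  · have hc : Nat.card (S q : Subgroup G) = 1 := by
      rw [Sylow.card_eq_multiplicity, Nat.factorization_eq_zero_of_not_dvd, pow_zero]
      intro hdvd
      exact hqT (Finset.mem_subtype.mpr (Nat.mem_primeFactors.mpr
        ⟨q.2, hdvd, Nat.card_pos.ne'⟩))
    have := (Nat.card_eq_one_iff_unique.mp hc).1
    exact fun g _ => Subsingleton.elim _ _

theorem IsNondegenerateCocycle.isSymplecticAction_sylow [Finite G] {p : ℕ} [Fact p.Prime]
    (S : Sylow p G) (hS : IsMulCommutative (S : Subgroup G)) {f : twoCocycles G}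
    (hf : IsNondegenerateCocycle f) :
    IsCentralType (S : Subgroup G) ∧ IsSymplecticAction (weylAction (S : Subgroup G) hS) := by
  have h : IsNondegenerateCocycle (comap (S : Subgroup G).subtype f) :=
    (hf.comap_sylow S hS).isNondegenerateCocycle fun g h => mul_comm' g h
  exact ⟨⟨_, h⟩, _, ⟨_, rfl, h⟩, range_weylAction_le_symplecticGroup_comap _ hS f⟩

end CentralType

theorem mainTheorem7 {G : Type*} [Group G] [Finite G] (hG : CentralType.IsAType G)
    (S : (p : Nat.Primes) → Sylow (p : ℕ) G) :
    CentralType.IsCentralType G ↔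
      ∀ p : Nat.Primes, CentralType.IsCentralType (S p : Subgroup G) ∧
        CentralType.IsSymplecticAction
          (CentralType.weylAction (S p : Subgroup G) (hG p p.2 (S p))) := by
  constructor
  · rintro ⟨f, hf⟩ p
    have := Fact.mk p.2
    exact hf.isSymplecticAction_sylow (S p) _
  · exact fun h => CentralType.isCentralType_of_isSymplecticAction hG S fun p => (h p).2
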